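/- Consider a line network $A=v_0,v_1,\dots,v_M=B$ with $M\ge 1$ links, link $i$ joining $v_{i-1}$ and $v_i$, in discrete time, and an unlimited supply of requests at $A$, all to be sent to $B$. Let $p\in(0,1]$ and let $T_{ij}$ ($1\le i\le M$, $j\ge 1$) be independent random variables, each geometric with parameter $p$: $P(T_{ij}=n)=(1-p)^{n-1}p$ for $n\ge 1$. Here $T_{ij}$ is the number of time slots that the $j$-th generation of link $i$ takes, counted from time $0$ if $j=1$ and from the moment when the link is consumed for the $(j-1)$-st time if $j>1$. A generated link stays generated until a request crosses it; the crossing consumes the link, whose next generation then starts. Forwarding is opportunistic: at the end of each slot every request moves forward along the line over generated links as far as it can, one request per generated link, swaps taking no time and always succeeding. Let $N_t$ be the number of requests that have reached $B$ by time $t\in\mathbb N$. Then each $N_t$ is integrable, the limit $$R=\lim_{t\to\infty}\frac{E\{N_t\}}{t}$$ exists and is finite, and with probability one $\lim_{t\to\infty} N_t/t = R$. -/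

import Mathlib

/-- The state, at the end of a time slot, of a line network `A = v₀ — v₁ — ⋯ — v_M = B` whose
links are numbered from `A` to `B`; link `k : Fin M` joins `v_k` and `v_{k+1}`. -/
structure LineState (M : ℕ) where
  /-- Number of requests that have crossed link `k` so far (each crossing consumes the link). -/
  crossed : Fin M → ℕ
  /-- Number of slots elapsed since link `k` was last consumed (or since the start). -/
  age : Fin M → ℕ

namespace LineState

variable {M : ℕ}

/-- At time `0` no request has moved and every link starts its first generation. -/
def init (M : ℕ) : LineState M where
  crossed _ := 0
  age _ := 0

/-- Link `k` is in the generated state when the swaps of the slot following `s` take place: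
`T k j` is the number of slots which the `(j + 1)`-st generation of link `k` takes, counted from
the moment at which the link was consumed for the `j`-th time. A generated link stays generated
until it is consumed. -/
def isUp (T : Fin M → ℕ → ℕ) (s : LineState M) (k : Fin M) : Bool :=
  decide (T k (s.crossed k) ≤ s.age k + 1)

/-- Whether a request crosses link `k` in the slot following `s`: the link has to be generated,
and a request has to be at its left end. There is always a request at the source `v₀`; at `v_{k+1}`
either a request was already waiting, or one arrives in the same slot over link `k`
(a swap takes no time, so a request moves on as far as it can). -/
def hops (T : Fin M → ℕ → ℕ) (s : LineState M) : (k : ℕ) → k < M → Bool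
  | 0, h => isUp T s ⟨0, h⟩
  | k + 1, h =>
      isUp T s ⟨k + 1, h⟩ &&
        (decide (s.crossed ⟨k + 1, h⟩ < s.crossed ⟨k, Nat.lt_of_succ_lt h⟩) ||
          hops T s k (Nat.lt_of_succ_lt h))

/-- One time slot of opportunistic forwarding: every request moves as soon and as far as it can,
and the links that are consumed start a new generation. -/
def step (T : Fin M → ℕ → ℕ) (s : LineState M) : LineState M where
  crossed k := if hops T s k k.isLt then s.crossed k + 1 else s.crossed k
  age k := if hops T s k k.isLt then 0 else s.age k + 1

/-- The state at time `t` (after `t` slots). -/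
def atTime (T : Fin M → ℕ → ℕ) : ℕ → LineState M
  | 0 => init M
  | t + 1 => step T (atTime T t)

end LineState

/-- `N_t`: the number of requests delivered to `B` by time `t` in the opportunistic line network
with `M ≥ 1` links, i.e. the number of requests that have crossed the last link. -/
def delivered {M : ℕ} (hM : 0 < M) (T : Fin M → ℕ → ℕ) (t : ℕ) : ℕ :=
  (LineState.atTime T t).crossed ⟨M - 1, Nat.sub_lt hM Nat.one_pos⟩

/-! ### Sample-path dynamics and busy periods. -/

namespace LineState

variable {M : ℕ}

/-! The rate is `R = 1 / m`, with `m` the mean generation time, whatever the number of links. The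
argument is pathwise: it needs only that each link's generation times average to `m`, which the
strong law gives almost surely. Upper bound: the generations used up by the last link fit into `t`
slots (`sum_add_age_le`), so `m * N_t ≤ t + o(t)`. Lower bound, by induction along the line
(`time_le_crossed`): look back to a time `u` when no request waited at the link, so that its count
`i` was at least that of the previous link, whence `u ≤ m * i + o(t)`. Since `u` the link has been
consumed as soon as generated, so `t - u` is at most about `m` times its crossings since then.
Adding the two bounds loses only `o(t)`. As `N_t ≤ t`, dominated convergence transfers the limit to
expectations. -/

theorem crossed_le (T : Fin M → ℕ → ℕ) (t : ℕ) (k : Fin M) : (atTime T t).crossed k ≤ t := by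
  induction t with
  | zero => simp [atTime, init]
  | succ t ih =>
    simp only [atTime, step]
    split_ifs <;> omega

/-- The generations of a link that have been used up fit into the elapsed time. -/
theorem sum_add_age_le (T : Fin M → ℕ → ℕ) (t : ℕ) (k : Fin M) :
    ∑ j ∈ Finset.range ((atTime T t).crossed k), T k j + (atTime T t).age k ≤ t := by
  induction t with
  | zero => simp [atTime, init]
  | succ t ih =>
    simp only [atTime, step]
    split_ifs with h
    · have hup : isUp T (atTime T t) k = true := by
        obtain ⟨k, hk⟩ := k
        cases k with
        | zero => simpa [hops] using h
        | succ k =>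
          simp only [hops, Bool.and_eq_true] at h
          exact h.1
      simp only [isUp, decide_eq_true_eq] at hup
      rw [Finset.sum_range_succ]
      omega
    · omega

/-- Link `k` starts a busy period at a time `u` at which the requests that have crossed it number
`i`; from then on, up to time `t`, it is consumed as soon as it is generated. -/
def BusyFrom (T : Fin M → ℕ → ℕ) (k : Fin M) (t u i : ℕ) : Prop :=
  u ≤ t ∧ i ≤ u ∧ i ≤ (atTime T t).crossed k ∧
  t + ∑ j ∈ Finset.range i, T k j ≤
    u + ∑ j ∈ Finset.range ((atTime T t).crossed k), T k j + (atTime T t).age k ∧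
  t + ∑ j ∈ Finset.range i, T k j <
    u + ∑ j ∈ Finset.range ((atTime T t).crossed k + 1), T k j

theorem BusyFrom.refl {T : Fin M → ℕ → ℕ} (hT : ∀ k j, 1 ≤ T k j) (k : Fin M) (t : ℕ) :
    BusyFrom T k t t ((atTime T t).crossed k) := by
  have := hT k ((atTime T t).crossed k)
  refine ⟨le_rfl, crossed_le T t k, le_rfl, by omega, ?_⟩
  rw [Finset.sum_range_succ]
  omega

/-- The two inequalities feed each other. After a crossing the age is `0`, and the old strict bound
becomes the new weak one. Without a crossing the link is not up, so its current generation time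
exceeds `age + 1`, and the weak bound yields the strict one. -/
theorem BusyFrom.succ {T : Fin M → ℕ → ℕ} (hT : ∀ k j, 1 ≤ T k j) {k : Fin M} {t u i : ℕ}
    (h : BusyFrom T k t u i)
    (hk : isUp T (atTime T t) k = true → hops T (atTime T t) k k.isLt = true) :
    BusyFrom T k (t + 1) u i := by
  obtain ⟨h1, h2, h3, h4, h5⟩ := h
  have := hT k ((atTime T t).crossed k + 1)
  rw [Finset.sum_range_succ] at h5
  by_cases hh : hops T (atTime T t) k k.isLt = true
  · simp only [BusyFrom, atTime, step, if_pos hh, Finset.sum_range_succ]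
    omega
  · have hup : ¬ isUp T (atTime T t) k = true := fun h => hh (hk h)
    simp only [isUp, decide_eq_true_eq] at hup
    simp only [BusyFrom, atTime, step, if_neg hh, Finset.sum_range_succ]
    omega

theorem busyFrom_first {T : Fin M → ℕ → ℕ} (hT : ∀ k j, 1 ≤ T k j) (h : 0 < M) (t : ℕ) :
    BusyFrom T ⟨0, h⟩ t 0 0 := by
  induction t with
  | zero => exact BusyFrom.refl hT ⟨0, h⟩ 0
  | succ t ih => exact ih.succ hT fun hup => by simpa [hops] using hup

/-- Restart the period whenever no request waits at the link. If one waits after the slot, then an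
up link must have been crossed: otherwise nothing was waiting or arriving, and nothing would wait
now. -/
theorem exists_busyFrom_succ {T : Fin M → ℕ → ℕ} (hT : ∀ k j, 1 ≤ T k j) {k : ℕ}
    (h : k + 1 < M) (t : ℕ) :
    ∃ u i, BusyFrom T ⟨k + 1, h⟩ t u i ∧
      (atTime T u).crossed ⟨k, Nat.lt_of_succ_lt h⟩ ≤ i := by
  induction t with
  | zero => exact ⟨0, 0, BusyFrom.refl hT ⟨k + 1, h⟩ 0, by simp [atTime, init]⟩
  | succ t ih =>
    by_cases hc : (atTime T (t + 1)).crossed ⟨k, Nat.lt_of_succ_lt h⟩ ≤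
        (atTime T (t + 1)).crossed ⟨k + 1, h⟩
    · exact ⟨t + 1, _, BusyFrom.refl hT _ _, hc⟩
    · obtain ⟨u, i, hb, hi⟩ := ih
      refine ⟨u, i, hb.succ hT fun hup => ?_, hi⟩
      by_contra hh
      simp only [atTime, step, if_neg hh] at hc
      simp only [hops, hup, Bool.true_and, Bool.or_eq_true, decide_eq_true_eq, not_or] at hh
      rw [if_neg hh.2] at hc
      omega

/-- If the generation times of each link average to `m`, every link is crossed once every `m`
slots, up to an error that is sublinear in time. -/
theorem time_le_crossed {T : Fin M → ℕ → ℕ} (hT : ∀ k j, 1 ≤ T k j) {m : ℝ}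
    (hm : ∀ k, ∀ ε : ℝ, 0 < ε → ∃ C : ℝ, ∀ n : ℕ,
      |((∑ j ∈ Finset.range n, T k j : ℕ) : ℝ) - m * n| ≤ ε * n + C)
    (k : ℕ) (hk : k < M) (ε : ℝ) (hε : 0 < ε) :
    ∃ C : ℝ, ∀ t : ℕ, (t : ℝ) ≤ m * (atTime T t).crossed ⟨k, hk⟩ + ε * t + C := by
  have key : ∀ k : Fin M, ∀ ε : ℝ, 0 < ε → ∀ D : ℝ, (∀ t : ℕ, ∃ u i, BusyFrom T k t u i ∧
      (u : ℝ) ≤ m * i + ε * u + D) →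
      ∃ C : ℝ, ∀ t : ℕ, (t : ℝ) ≤ m * (atTime T t).crossed k + 3 * ε * t + C := by
    intro k ε hε D hD
    obtain ⟨C, hC⟩ := hm k ε hε
    -- `i` cancels between the bound on `u` and the two averages. The errors `ε * u`, `ε * i` and `ε
    -- * crossed` are each at most `ε * t`; the extra `m + ε` comes from the unfinished generation.
    refine ⟨D + 2 * C + m + ε, fun t => ?_⟩
    obtain ⟨u, i, ⟨h1, h2, h3, -, h5⟩, hu⟩ := hD t
    have hct : ((atTime T t).crossed k : ℝ) ≤ t := by exact_mod_cast crossed_le T t k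
    have h1' : (u : ℝ) ≤ t := by exact_mod_cast h1
    have h3' : (i : ℝ) ≤ t := by exact_mod_cast h2.trans h1
    have h5' := (Nat.cast_lt (α := ℝ)).2 h5
    simp only [Nat.cast_add] at h5'
    have hCi := (abs_le.1 (hC i)).1
    have hCc := (abs_le.1 (hC ((atTime T t).crossed k + 1))).2
    push_cast at hCi hCc h5'
    have e1 := mul_le_mul_of_nonneg_left hct hε.le
    have e2 := mul_le_mul_of_nonneg_left h1' hε.le
    have e3 := mul_le_mul_of_nonneg_left h3' hε.le
    linarith
  have hm0 : 0 ≤ m := by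
    by_contra! hneg
    obtain ⟨C, hC⟩ := hm ⟨k, hk⟩ (-m / 2) (by linarith)
    obtain ⟨n, hn⟩ := exists_nat_gt (C / (-m / 2))
    rw [div_lt_iff₀ (by linarith)] at hn
    have h1 := (abs_le.1 (hC n)).2
    have h2 : (0 : ℝ) ≤ ((∑ j ∈ Finset.range n, T ⟨k, hk⟩ j : ℕ) : ℝ) := Nat.cast_nonneg _
    linarith
  induction k generalizing ε with
  | zero =>
    obtain ⟨C, hC⟩ := key ⟨0, hk⟩ (ε / 3) (by positivity) 0
      fun t => ⟨0, 0, busyFrom_first hT hk t, by simp⟩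
    exact ⟨C, fun t => (hC t).trans_eq (by ring)⟩
  | succ k ih =>
    obtain ⟨D, hD⟩ := ih (Nat.lt_of_succ_lt hk) (ε / 3) (by positivity)
    obtain ⟨C, hC⟩ := key ⟨k + 1, hk⟩ (ε / 3) (by positivity) D fun t => by
      obtain ⟨u, i, hb, hi⟩ := exists_busyFrom_succ hT hk t
      have hi' : ((atTime T u).crossed ⟨k, Nat.lt_of_succ_lt hk⟩ : ℝ) ≤ i := by exact_mod_cast hi
      have := mul_le_mul_of_nonneg_left hi' hm0
      exact ⟨u, i, hb, by linarith [hD u]⟩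
    exact ⟨C, fun t => (hC t).trans_eq (by ring)⟩

/-! ### Measurability of the dynamics. -/

theorem measurable_atTime (t : ℕ) :
    (∀ k, Measurable fun T : Fin M → ℕ → ℕ => (atTime T t).crossed k) ∧
      ∀ k, Measurable fun T : Fin M → ℕ → ℕ => (atTime T t).age k := by
  induction t with
  | zero => simp [atTime, init]
  | succ t ih =>
    obtain ⟨hc, ha⟩ := ih
    have hup : ∀ k, Measurable fun T : Fin M → ℕ → ℕ => isUp T (atTime T t) k := by
      intro k
      have heval : Measurable fun q : (Fin M → ℕ → ℕ) × ℕ => q.1 k q.2 :=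
        
        -- The generation index is itself random; as it takes countably many values, evaluation at
        -- it is measurable.
        measurable_from_prod_countable_left fun j =>
          (measurable_pi_apply j).comp (measurable_pi_apply k)
      have h1 : Measurable fun T : Fin M → ℕ → ℕ => T k ((atTime T t).crossed k) :=
        heval.comp (measurable_id.prodMk (hc k))
      exact (Measurable.of_discrete (f := fun q : ℕ × ℕ => decide (q.1 ≤ q.2 + 1))).comp
        (h1.prodMk (ha k))
    have hhop : ∀ k (hk : k < M),
        Measurable fun T : Fin M → ℕ → ℕ => hops T (atTime T t) k hk := by
      intro k
      induction k with
      | zero => exact fun hk => hup ⟨0, hk⟩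
      | succ k ih =>
        intro hk
        exact (Measurable.of_discrete
          (f := fun q : (Bool × Bool) × ℕ × ℕ => q.1.1 && (decide (q.2.1 < q.2.2) || q.1.2))).comp
          (((hup ⟨k + 1, hk⟩).prodMk (ih (Nat.lt_of_succ_lt hk))).prodMk
            ((hc ⟨k + 1, hk⟩).prodMk (hc ⟨k, Nat.lt_of_succ_lt hk⟩)))
    refine ⟨fun k => ?_, fun k => ?_⟩
    · exact (Measurable.of_discrete
        (f := fun q : Bool × ℕ => if q.1 then q.2 + 1 else q.2)).comp ((hhop k k.isLt).prodMk (hc k))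
    · exact (Measurable.of_discrete
        (f := fun q : Bool × ℕ => if q.1 then 0 else q.2 + 1)).comp ((hhop k k.isLt).prodMk (ha k))

end LineState

/-! ### From averages to the throughput of a sample path. -/

/-- Convergence of averages in the form of a linear error bound. -/
theorem exists_abs_sub_le_of_tendsto_div {s : ℕ → ℝ} {m : ℝ}
    (h : Filter.Tendsto (fun n : ℕ => s n / n) Filter.atTop (nhds m)) {ε : ℝ} (hε : 0 < ε) :
    ∃ C : ℝ, ∀ n : ℕ, |s n - m * n| ≤ ε * n + C := by
  obtain ⟨N, hN⟩ := Metric.tendsto_atTop.1 h ε hε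
  -- The term `|s 0|` covers `n = 0` when `N = 0`, where the quotient `s 0 / 0 = 0` carries no
  -- information.
  refine ⟨|s 0| + ∑ n ∈ Finset.range N, |s n - m * n|, fun n => ?_⟩
  have hs : 0 ≤ ∑ n ∈ Finset.range N, |s n - m * n| := Finset.sum_nonneg fun _ _ => abs_nonneg _
  have hn0 : 0 ≤ ε * n := by positivity
  rcases lt_or_ge n N with hn | hn
  · have := Finset.single_le_sum (f := fun n : ℕ => |s n - m * n|) (fun _ _ => abs_nonneg _)
      (Finset.mem_range.2 hn)
    have h0 := abs_nonneg (s 0)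
    linarith
  · rcases Nat.eq_zero_or_pos n with rfl | hpos
    · simp only [Nat.cast_zero, mul_zero, sub_zero, zero_add]
      linarith
    · have hp : (0 : ℝ) < n := by exact_mod_cast hpos
      have h1 := hN n hn
      rw [Real.dist_eq, div_sub' hp.ne', abs_div, abs_of_pos hp, div_lt_iff₀ hp,
        mul_comm (n : ℝ) m] at h1
      linarith [abs_nonneg (s 0)]

theorem tendsto_div_of_abs_sub_le {c : ℕ → ℝ} {m : ℝ} (hm : 0 < m)
    (h : ∀ ε : ℝ, 0 < ε → ∃ C : ℝ, ∀ t : ℕ, |(t : ℝ) - m * c t| ≤ ε * t + C) :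
    Filter.Tendsto (fun t : ℕ => c t / t) Filter.atTop (nhds m⁻¹) := by
  rw [Metric.tendsto_atTop]
  intro ε hε
  -- Half of the tolerance `m * ε * t` absorbs the linear error, the other half absorbs `C` for
  -- large `t`.
  obtain ⟨C, hC⟩ := h (m * ε / 2) (by positivity)
  obtain ⟨N, hN⟩ := exists_nat_gt (C / (m * ε / 2))
  refine ⟨N + 1, fun t ht => ?_⟩
  have ht0 : (0 : ℝ) < t := by exact_mod_cast (by omega : 0 < t)
  have hNt : (N : ℝ) ≤ t := by exact_mod_cast (by omega : N ≤ t)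
  have hCt := hN.trans_le hNt
  rw [div_lt_iff₀ (by positivity)] at hCt
  have h1 := hC t
  have : c t / t - m⁻¹ = -(t - m * c t) / (m * t) := by
    field_simp
    ring
  rw [Real.dist_eq, this, abs_div, abs_neg, abs_of_pos (mul_pos hm ht0),
    div_lt_iff₀ (by positivity)]
  linarith

/-- The throughput of the line is the reciprocal of the mean generation time of its links. -/
theorem tendsto_delivered_div {M : ℕ} (hM : 0 < M) {T : Fin M → ℕ → ℕ}
    (hT : ∀ k j, 1 ≤ T k j) {m : ℝ} (hm0 : 0 < m)
    (hm : ∀ k, Filter.Tendsto (fun n : ℕ => (∑ j ∈ Finset.range n, (T k j : ℝ)) / n)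
      Filter.atTop (nhds m)) :
    Filter.Tendsto (fun t : ℕ => (delivered hM T t : ℝ) / t) Filter.atTop (nhds m⁻¹) := by
  have hm' : ∀ k, ∀ ε : ℝ, 0 < ε → ∃ C : ℝ, ∀ n : ℕ,
      |((∑ j ∈ Finset.range n, T k j : ℕ) : ℝ) - m * n| ≤ ε * n + C := fun k ε hε =>
    exists_abs_sub_le_of_tendsto_div (by simpa using hm k) hε
  refine tendsto_div_of_abs_sub_le hm0 fun ε hε => ?_
  set k : Fin M := ⟨M - 1, Nat.sub_lt hM Nat.one_pos⟩
  obtain ⟨C, hC⟩ := LineState.time_le_crossed hT hm' k k.isLt ε hε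
  obtain ⟨D, hD⟩ := hm' k ε hε
  refine ⟨max C D, fun t => abs_le.2 ⟨?_, ?_⟩⟩
  · have h1 := (abs_le.1 (hD (delivered hM T t))).1
    have h2 : ((∑ j ∈ Finset.range (delivered hM T t), T k j : ℕ) : ℝ) ≤ t := by
      exact_mod_cast (Nat.le_add_right _ _).trans (LineState.sum_add_age_le T t k)
    have h3 : (delivered hM T t : ℝ) ≤ t := by exact_mod_cast LineState.crossed_le T t k
    have h4 := mul_le_mul_of_nonneg_left h3 hε.le
    linarith [le_max_right C D]
  · have h1 : (t : ℝ) ≤ m * delivered hM T t + ε * t + C := hC t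
    linarith [le_max_left C D]

/-! ### Geometric generation times and the almost sure limit. -/

theorem integrable_add_one_geometricMeasure {p : unitInterval} (hp : p ≠ 0) :
    MeasureTheory.Integrable (fun n : ℕ => ((n + 1 : ℕ) : ℝ))
      (ProbabilityTheory.geometricMeasure p) := by
  rw [ProbabilityTheory.integrable_geometricMeasure_iff hp]
  have hp0 : (0 : ℝ) < p := lt_of_le_of_ne p.2.1 fun h => hp (Subtype.ext h.symm)
  have hr : ‖(1 - p : ℝ)‖ < 1 := by
    rw [Real.norm_eq_abs, abs_lt]
    constructor <;> linarith [p.2.2]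
  have h1 := summable_pow_mul_geometric_of_norm_lt_one 1 hr
  have h0 := summable_pow_mul_geometric_of_norm_lt_one 0 hr
  refine ((h1.add h0).mul_right (p : ℝ)).congr fun n => ?_
  rw [Real.norm_natCast]
  push_cast
  ring

theorem mainTheorem3 {Ω : Type*} [MeasurableSpace Ω] (μ : MeasureTheory.Measure Ω)
    [MeasureTheory.IsProbabilityMeasure μ]
    {M : ℕ} (hM : 0 < M) (p : unitInterval) (hp : p ≠ 0)
    (T : Fin M → ℕ → Ω → ℕ)
    (hindep : ProbabilityTheory.iIndepFun (fun x : Fin M × ℕ => T x.1 x.2) μ)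
    (hlaw : ∀ i j, ProbabilityTheory.HasLaw (T i j)
      ((ProbabilityTheory.geometricMeasure p).map (fun n => n + 1)) μ) :
    (∀ t : ℕ, MeasureTheory.Integrable
      (fun ω => (delivered hM (fun i j => T i j ω) t : ℝ)) μ) ∧
    ∃ R : ℝ,
      Filter.Tendsto
        (fun t : ℕ => (∫ ω, (delivered hM (fun i j => T i j ω) t : ℝ) ∂μ) / (t : ℝ))
        Filter.atTop (nhds R) ∧
      ∀ᵐ ω ∂μ, Filter.Tendsto
        (fun t : ℕ => (delivered hM (fun i j => T i j ω) t : ℝ) / (t : ℝ))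
        Filter.atTop (nhds R) := by
  have hmeas : ∀ t, MeasureTheory.AEStronglyMeasurable
      (fun ω => (delivered hM (fun i j => T i j ω) t : ℝ)) μ := by
    intro t
    have hTm : AEMeasurable (fun ω i j => T i j ω) μ :=
      aemeasurable_pi_lambda _ fun i => aemeasurable_pi_lambda _ fun j => (hlaw i j).aemeasurable
    have hd : Measurable fun S : Fin M → ℕ → ℕ => (delivered hM S t : ℝ) :=
      measurable_from_top.comp ((LineState.measurable_atTime t).1 _)
    exact (hd.comp_aemeasurable hTm).aestronglyMeasurable
  have hle : ∀ t ω, (delivered hM (fun i j => T i j ω) t : ℝ) ≤ t := fun t ω => by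
    exact_mod_cast LineState.crossed_le _ t _
  have hint : ∀ t : ℕ, MeasureTheory.Integrable
      (fun ω => (delivered hM (fun i j => T i j ω) t : ℝ)) μ := fun t =>
    MeasureTheory.Integrable.of_bound (hmeas t) t
      (Filter.Eventually.of_forall fun ω => by simpa using hle t ω)
  have hpos : ∀ᵐ ω ∂μ, ∀ i j, 1 ≤ T i j ω := by
    simp only [MeasureTheory.ae_all_iff]
    intro i j
    rw [(hlaw i j).ae_iff (p := fun n => 1 ≤ n) Measurable.of_discrete,
      MeasureTheory.ae_map_iff (Measurable.of_discrete.aemeasurable) MeasurableSet.of_discrete]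
    exact Filter.Eventually.of_forall fun n => Nat.le_add_left 1 n
  have hid : ∀ i j i' j', ProbabilityTheory.IdentDistrib (fun ω => (T i j ω : ℝ))
      (fun ω => (T i' j' ω : ℝ)) μ μ := fun i j i' j' =>
    ((hlaw i j).identDistrib (hlaw i' j')).comp (u := fun n : ℕ => (n : ℝ)) Measurable.of_discrete
  have hTint : ∀ i j, MeasureTheory.Integrable (fun ω => (T i j ω : ℝ)) μ := by
    intro i j
    have h : MeasureTheory.Integrable (fun n : ℕ => (n : ℝ)) (μ.map (T i j)) := by
      rw [(hlaw i j).map_eq, MeasureTheory.integrable_map_measure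
        Measurable.of_discrete.aestronglyMeasurable Measurable.of_discrete.aemeasurable]
      exact integrable_add_one_geometricMeasure hp
    exact h.comp_aemeasurable (hlaw i j).aemeasurable
  set m : ℝ := ∫ ω, (T ⟨0, hM⟩ 0 ω : ℝ) ∂μ with hm_def
  have hm1 : 1 ≤ m := by
    have h : ∫ _, (1 : ℝ) ∂μ ≤ m := MeasureTheory.integral_mono_ae
      (MeasureTheory.integrable_const 1) (hTint _ _) <| by
        filter_upwards [hpos] with ω hω
        exact_mod_cast hω ⟨0, hM⟩ 0
    simpa using h
  have hslln : ∀ᵐ ω ∂μ, ∀ k, Filter.Tendsto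
      (fun n : ℕ => (∑ j ∈ Finset.range n, (T k j ω : ℝ)) / n) Filter.atTop (nhds m) := by
    rw [MeasureTheory.ae_all_iff]
    intro k
    have h := ProbabilityTheory.strong_law_ae_real (μ := μ) (fun j ω => (T k j ω : ℝ))
      (hTint k 0)
      (fun i j hij => (hindep.indepFun (i := (k, i)) (j := (k, j)) (by simpa using hij)).comp
        (φ := fun n : ℕ => (n : ℝ)) (ψ := fun n : ℕ => (n : ℝ))
        Measurable.of_discrete Measurable.of_discrete)
      (fun i => hid k i k 0)
    rwa [(hid k 0 ⟨0, hM⟩ 0).integral_eq] at h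
  have hlim : ∀ᵐ ω ∂μ, Filter.Tendsto
      (fun t : ℕ => (delivered hM (fun i j => T i j ω) t : ℝ) / (t : ℝ))
      Filter.atTop (nhds m⁻¹) := by
    filter_upwards [hpos, hslln] with ω h1 h2
    exact tendsto_delivered_div hM h1 (by linarith) h2
  refine ⟨hint, m⁻¹, ?_, hlim⟩
  have h := MeasureTheory.tendsto_integral_of_dominated_convergence (μ := μ)
    (F := fun (t : ℕ) ω => (delivered hM (fun i j => T i j ω) t : ℝ) / (t : ℝ))
    (f := fun _ => m⁻¹) (fun _ => 1) (fun t => ((hint t).div_const _).aestronglyMeasurable)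
    (MeasureTheory.integrable_const 1)
    (fun t => Filter.Eventually.of_forall fun ω => by
      rw [Real.norm_of_nonneg (by positivity)]
      exact div_le_one_of_le₀ (hle t ω) (Nat.cast_nonneg t)) hlim
  simpa [MeasureTheory.integral_div] using h
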